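/- Let $\mathcal{A}$ be a complex unital Banach algebra. An element $a\in\mathcal{A}$ is called generalized Drazin invertible, written $a\in\mathcal{A}^d$, if there is an element $a^d\in\mathcal{A}$ (necessarily unique) such that $$a^d a a^d=a^d,\qquad a a^d=a^d a,\qquad a-a^2a^d \text{ is quasinilpotent},$$ where an element is quasinilpotent if its spectral radius is $0$. For $a\in\mathcal{A}^d$ put $a^\pi=1-aa^d$. Let $a,b\in\mathcal{A}^d$ with $b a^\pi=0$, and let $c=aa^d(a+b)$. Then $$a+b\in\mathcal{A}^d\iff c\in\mathcal{A}^d\iff a^2a^d+b\in\mathcal{A}^d.$$ If these equivalent conditions hold, then the series below converges in $\mathcal{A}$ (unconditionally) and $$(a+b)^d=c^d+\sum_{n=0}^{\infty}a^n a^\pi b\,(c^d)^{n+2}.$$ -/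

import Mathlib

open Filter Topology

noncomputable section

/-- `x` is quasinilpotent: its spectral radius (the supremum of `|z|` over the complex
spectrum) is zero. -/
def IsQuasinilpotent {A : Type*} [NormedRing A] [NormedAlgebra ℂ A] (x : A) : Prop :=
  spectralRadius ℂ x = 0

/-- `x` is a generalized Drazin (Koliha–Drazin) inverse of `a`. -/
structure IsGDrazinInverse {A : Type*} [NormedRing A] [NormedAlgebra ℂ A] (a x : A) : Prop where
  inner_eq : x * a * x = x
  comm : a * x = x * a
  quasinilpotent : IsQuasinilpotent (a - a ^ 2 * x)

/-- `a` is generalized Drazin invertible. -/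
def IsGDrazinInvertible {A : Type*} [NormedRing A] [NormedAlgebra ℂ A] (a : A) : Prop :=
  ∃ x : A, IsGDrazinInverse a x

open Classical in
/-- The generalized Drazin inverse of `a` (with the value `0` when `a` has none); it is unique by
`IsGDrazinInverse.unique` below. -/
def gDrazinInv {A : Type*} [NormedRing A] [NormedAlgebra ℂ A] (a : A) : A :=
  if h : IsGDrazinInvertible a then h.choose else 0

/-- The spectral idempotent `1 - a a^d` of `a` corresponding to `{0}`. -/
def spectralIdem {A : Type*} [NormedRing A] [NormedAlgebra ℂ A] (a : A) : A :=
  1 - a * gDrazinInv a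

theorem IsQuasinilpotent.tendsto {A : Type*} [NormedRing A] [NormedAlgebra ℂ A] [CompleteSpace A]
    {q : A} (hq : IsQuasinilpotent q) (C : ℝ) (hC : 0 ≤ C) :
    Tendsto (fun n : ℕ => C ^ n * ‖q ^ n‖) atTop (𝓝 0) := by
  have h := spectrum.pow_norm_pow_one_div_tendsto_nhds_spectralRadius q
  rw [show spectralRadius ℂ q = 0 from hq] at h
  have hpos : (0 : ENNReal) < ENNReal.ofReal (1 / (2 * (C + 1))) := by
    rw [ENNReal.ofReal_pos]; positivity
  have hev := h.eventually (gt_mem_nhds hpos)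
  have hgeo : Tendsto (fun n : ℕ => (1 / 2 : ℝ) ^ n) atTop (𝓝 0) :=
    tendsto_pow_atTop_nhds_zero_of_lt_one (by norm_num) (by norm_num)
  refine squeeze_zero' (Eventually.of_forall fun n => by positivity) ?_ hgeo
  filter_upwards [hev, eventually_gt_atTop 0] with n hn hn0
  have h1 : ‖q ^ n‖ ^ (1 / n : ℝ) < 1 / (2 * (C + 1)) :=
    (ENNReal.ofReal_lt_ofReal_iff (by positivity)).1 hn
  have h2 : ‖q ^ n‖ ≤ (1 / (2 * (C + 1))) ^ n := by
    have h3 := pow_le_pow_left₀ (by positivity) h1.le n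
    rwa [← Real.rpow_natCast (‖q ^ n‖ ^ (1 / n : ℝ)) n, ← Real.rpow_mul (norm_nonneg _),
      one_div_mul_cancel (by exact_mod_cast hn0.ne'), Real.rpow_one] at h3
  calc C ^ n * ‖q ^ n‖ ≤ C ^ n * (1 / (2 * (C + 1))) ^ n := by gcongr
    _ = (C * (1 / (2 * (C + 1)))) ^ n := (mul_pow _ _ _).symm
    _ ≤ (1 / 2) ^ n := by
      gcongr
      rw [mul_one_div, div_le_div_iff₀ (by positivity) (by norm_num)]
      linarith

theorem IsQuasinilpotent.eq_zero_of_eq {A : Type*} [NormedRing A] [NormedAlgebra ℂ A]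
    [CompleteSpace A] {q x z : A} (hq : IsQuasinilpotent q)
    (h : ∀ n : ℕ, 0 < n → z = x ^ n * q ^ n ∨ z = q ^ n * x ^ n) : z = 0 := by
  rw [← norm_le_zero_iff]
  refine ge_of_tendsto (hq.tendsto ‖x‖ (norm_nonneg _)) ?_
  filter_upwards [eventually_gt_atTop 0] with n hn
  have hx := norm_pow_le' x hn
  rcases h n hn with h | h
  · rw [h]
    exact (norm_mul_le _ _).trans (by gcongr)
  · rw [h, mul_comm]
    exact (norm_mul_le _ _).trans (by gcongr)

theorem IsGDrazinInverse.unique {A : Type*} [NormedRing A] [NormedAlgebra ℂ A] [CompleteSpace A]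
    {a x y : A} (hx : IsGDrazinInverse a x) (hy : IsGDrazinInverse a y) : x = y := by
  have pw : ∀ {w : A}, IsGDrazinInverse a w → ∀ n : ℕ, 0 < n →
      a ^ n * w ^ n = a * w ∧ w ^ n * a ^ n = a * w ∧
        (a - a ^ 2 * w) ^ n = a ^ n * (1 - a * w) ∧ (a - a ^ 2 * w) ^ n = (1 - a * w) * a ^ n := by
    intro w hw n hn
    have hc : Commute a w := hw.comm
    have hid : IsIdempotentElem (a * w) := by
      rw [IsIdempotentElem, mul_assoc, ← mul_assoc w, hw.inner_eq]
    have hc' : Commute a (1 - a * w) :=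
      (Commute.one_right a).sub_right ((Commute.refl a).mul_right hc)
    have e : a - a ^ 2 * w = a * (1 - a * w) := by noncomm_ring
    have h1 : a ^ n * w ^ n = a * w := by rw [← hc.mul_pow, hid.pow_eq hn.ne']
    have h3 : (a - a ^ 2 * w) ^ n = a ^ n * (1 - a * w) := by
      rw [e, hc'.mul_pow, hid.one_sub.pow_eq hn.ne']
    exact ⟨h1, by rw [← (hc.pow_pow n n).eq, h1], h3, by rw [h3, (hc'.pow_left n).eq]⟩
  have h1 : a * x * (1 - a * y) = 0 := by
    refine hy.quasinilpotent.eq_zero_of_eq (x := x) fun n hn => Or.inl ?_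
    rw [(pw hy n hn).2.2.1, ← mul_assoc, (pw hx n hn).2.1]
  have h2 : (1 - a * x) * (a * y) = 0 := by
    refine hx.quasinilpotent.eq_zero_of_eq (x := y) fun n hn => Or.inr ?_
    rw [(pw hx n hn).2.2.2, mul_assoc, (pw hy n hn).1]
  have h3 : a * x = a * y := by
    rw [mul_sub, mul_one, sub_eq_zero] at h1
    rw [sub_mul, one_mul, sub_eq_zero] at h2
    rw [h1, ← h2]
  calc x = x * (a * x) := by rw [← mul_assoc, hx.inner_eq]
    _ = x * a * y := by rw [h3, mul_assoc]
    _ = y * a * y := by rw [← hx.comm, h3, hy.comm]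
    _ = y := hy.inner_eq

theorem gDrazinInv_eq {A : Type*} [NormedRing A] [NormedAlgebra ℂ A] [CompleteSpace A]
    {a x : A} (hx : IsGDrazinInverse a x) : gDrazinInv a = x := by
  have h : IsGDrazinInvertible a := ⟨x, hx⟩
  rw [gDrazinInv, dif_pos h]
  exact h.choose_spec.unique hx

end

/-! ### Quasinilpotent elements: sums, triangular blocks, decay of powers. -/

section Quasinilpotent

variable {A : Type*} [NormedRing A] [NormedAlgebra ℂ A]

/-! Put `p = a * x` with `x` the inverse of `a`, and `s = a + b`. Since `b * (1 - p) = 0`, relative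
to the idempotent `p` the element `s` is block lower triangular: its upper diagonal block is `c = p
* s`, and its lower one is the quasinilpotent `a * (1 - p)`. The element `a ^ 2 * x + b` has the
same upper block and lower block `0`. A quasinilpotent lower block has generalized Drazin inverse
`0`, so invertibility is decided by `c` alone, which gives both equivalences
(`isGDrazinInvertible_iff_of_triangular`). The inverse of `s` then has only `d`, the inverse of `c`,
and a lower off-diagonal corner `X`. Commuting with `s` forces `X * c = u * d + q * X`, with `q` the
lower block and `u` the corner of `s`; iterating this yields the series
(`IsGDrazinInverse.of_triangular`). -/

theorem isQuasinilpotent_iff_isUnit {x : A} :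
    IsQuasinilpotent x ↔ ∀ z : ℂ, IsUnit (1 - z • x) := by
  have key : IsQuasinilpotent x ↔ ∀ k ∈ spectrum ℂ x, k = 0 := by
    simp [IsQuasinilpotent, spectralRadius]
  rw [key]
  constructor
  · intro h z
    rcases eq_or_ne z 0 with rfl | hz
    · simp
    · have h1 : z⁻¹ ∉ spectrum ℂ x := fun hmem => inv_ne_zero hz (h _ hmem)
      rw [spectrum.notMem_iff, Algebra.algebraMap_eq_smul_one] at h1
      have h2 := h1.smul (Units.mk0 z hz)
      rwa [Units.smul_mk0, smul_sub, smul_smul, mul_inv_cancel₀ hz, one_smul] at h2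
  · intro h k hk
    by_contra hk0
    refine hk ?_
    have h2 := (h k⁻¹).smul (Units.mk0 k hk0)
    rwa [Units.smul_mk0, smul_sub, smul_smul, mul_inv_cancel₀ hk0, one_smul,
      ← Algebra.algebraMap_eq_smul_one] at h2

theorem isQuasinilpotent_zero : IsQuasinilpotent (0 : A) :=
  isQuasinilpotent_iff_isUnit.2 fun z => by simp

theorem IsQuasinilpotent.of_mul_self_eq_zero {x : A} (h : x * x = 0) : IsQuasinilpotent x := by
  refine isQuasinilpotent_iff_isUnit.2 fun z => IsNilpotent.isUnit_one_sub ⟨2, ?_⟩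
  rw [sq, smul_mul_smul_comm, h, smul_zero]

/-- As `x * y = 0`, `1 - z • (x + y)` factors as `(1 - z • x) * (1 - z • y)`, and the second factor
is a unit. -/
theorem isQuasinilpotent_add_iff {x y : A} (hxy : x * y = 0) (hy : IsQuasinilpotent y) :
    IsQuasinilpotent (x + y) ↔ IsQuasinilpotent x := by
  simp only [isQuasinilpotent_iff_isUnit] at hy ⊢
  refine forall_congr' fun z => ?_
  have e : 1 - z • (x + y) = (1 - z • x) * (1 - z • y) := by
    rw [sub_mul, mul_sub, mul_sub, smul_mul_smul_comm, hxy, smul_zero, smul_add]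
    noncomm_ring
  obtain ⟨v, hv⟩ := hy z
  rw [e, ← hv, Units.isUnit_mul_units]

/-- A block lower triangular element whose lower diagonal block is quasinilpotent is
quasinilpotent iff its upper diagonal block is. -/
theorem isQuasinilpotent_iff_of_triangular {p r : A} (hp : p * p = p)
    (hr : p * r * (1 - p) = 0) (hq : IsQuasinilpotent (r * (1 - p))) :
    IsQuasinilpotent r ↔ IsQuasinilpotent (p * r) := by
  have e1 : (1 - p) * r = (1 - p) * r * p + r * (1 - p) := by
    have : r * (1 - p) = (1 - p) * r * (1 - p) + p * r * (1 - p) := by noncomm_ring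
    rw [this, hr]; noncomm_ring
  have hlow : IsQuasinilpotent ((1 - p) * r) := by
    -- The corner `(1 - p) * r * p` squares to zero and kills `r * (1 - p)` from the left.
    rw [e1]
    refine (isQuasinilpotent_add_iff ?_ hq).2 (.of_mul_self_eq_zero ?_)
    · rw [mul_assoc ((1 - p) * r), ← mul_assoc p, hr, mul_zero]
    · rw [mul_assoc ((1 - p) * r), mul_assoc (1 - p) r p, ← mul_assoc p,
        mul_sub, mul_one, hp, sub_self, zero_mul, mul_zero]
  have e2 : r = p * r + (1 - p) * r := by noncomm_ring
  conv_lhs => rw [e2]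
  refine isQuasinilpotent_add_iff ?_ hlow
  rw [← mul_assoc, hr, zero_mul]

theorem IsQuasinilpotent.summable_mul_pow [CompleteSpace A] {q : A} (hq : IsQuasinilpotent q)
    (u d : A) : Summable fun n : ℕ => q ^ n * u * d ^ (n + 1) := by
  -- Powers of `q` decay faster than any geometric sequence; the extra factor 2 leaves the summable
  -- bound `(1 / 2) ^ n`.
  have hlim := hq.tendsto (2 * ‖d‖) (by positivity)
  have hgeo : Summable fun n : ℕ => (1 / 2 : ℝ) ^ n * (‖u‖ * ‖d‖) :=
    (summable_geometric_of_lt_one (by norm_num) (by norm_num)).mul_right _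
  refine hgeo.of_norm_bounded_eventually_nat ?_
  filter_upwards [hlim.eventually (gt_mem_nhds one_pos)] with n hn
  have h1 : ‖d‖ ^ n * ‖q ^ n‖ ≤ (1 / 2) ^ n := by
    rw [one_div, inv_pow, ← one_div, le_div_iff₀ (by positivity)]
    rw [mul_pow] at hn
    linarith
  calc ‖q ^ n * u * d ^ (n + 1)‖ ≤ ‖q ^ n‖ * ‖u‖ * ‖d‖ ^ (n + 1) :=
        (norm_mul_le _ _).trans (mul_le_mul (norm_mul_le _ _) (norm_pow_le' d n.succ_pos)
          (norm_nonneg _) (by positivity))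
    _ = ‖d‖ ^ n * ‖q ^ n‖ * (‖u‖ * ‖d‖) := by ring
    _ ≤ _ := by gcongr

end Quasinilpotent

/-! ### Generalized Drazin inverses of block triangular elements. -/

section Triangular

variable {A : Type*} [NormedRing A] [NormedAlgebra ℂ A]

theorem IsGDrazinInverse.sq_mul {a x : A} (h : IsGDrazinInverse a x) : x ^ 2 * a = x := by
  rw [sq, mul_assoc, ← h.comm, ← mul_assoc, h.inner_eq]

theorem IsGDrazinInverse.mul_sq {a x : A} (h : IsGDrazinInverse a x) : a * x ^ 2 = x := by
  rw [sq, ← mul_assoc, h.comm, h.inner_eq]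

variable [CompleteSpace A]

/-- The upper diagonal block of the generalized Drazin inverse of a block lower triangular element
with quasinilpotent lower diagonal block. -/
theorem IsGDrazinInverse.compress_of_triangular {p s y : A} (hp : p * p = p)
    (hs : p * s * (1 - p) = 0) (hq : IsQuasinilpotent (s * (1 - p)))
    (hy : IsGDrazinInverse s y) : IsGDrazinInverse (p * s) (p * y) := by
  have hsp : p * s * p = p * s := by
    rw [mul_sub, mul_one, sub_eq_zero] at hs
    exact hs.symm
  have hqs : (1 - p) * (s * (1 - p)) = s * (1 - p) := by
    rw [sub_mul, one_mul, ← mul_assoc p, hs, sub_zero]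
  have hpow : ∀ n : ℕ, s ^ n * (1 - p) = (1 - p) * (s * (1 - p)) ^ n := by
    intro n
    induction n with
    | zero => simp
    | succ n ih =>
      rw [pow_succ, mul_assoc, ← hqs, ← mul_assoc, ih, hqs, mul_assoc, ← pow_succ]
  have hyq : y * (1 - p) = 0 := by
    -- The idempotent `y * s` equals its powers `y ^ n * s ^ n`, so this product is `y ^ n * (s * (1
    -- - p)) ^ n` for every positive `n`, which tends to `0`.
    have h1 : s * y * (1 - p) = 0 := by
      refine hq.eq_zero_of_eq (x := y) fun n hn => Or.inl ?_
      obtain ⟨m, rfl⟩ : ∃ m, n = m + 1 := ⟨n - 1, by omega⟩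
      have hid : IsIdempotentElem (y * s) := by
        rw [IsIdempotentElem, ← mul_assoc, hy.inner_eq]
      have hc : Commute y s := hy.comm.symm
      have hfix : (1 - p) * (s * (1 - p)) ^ (m + 1) = (s * (1 - p)) ^ (m + 1) := by
        rw [pow_succ', ← mul_assoc, hqs]
      rw [← hfix, ← hpow, ← mul_assoc, ← hc.mul_pow, hid.pow_eq m.succ_ne_zero, hy.comm]
    rw [← hy.inner_eq, mul_assoc y, mul_assoc y, h1, mul_zero]
  have hyp : y * p = y := by
    rw [mul_sub, mul_one, sub_eq_zero] at hyq
    exact hyq.symm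
  have hcd : p * s * (p * y) = p * (s * y) := by rw [← mul_assoc, hsp, mul_assoc]
  have hdc : p * y * (p * s) = p * (s * y) := by
    rw [← mul_assoc, mul_assoc p y p, hyp, mul_assoc, hy.comm]
  refine ⟨?_, by rw [hcd, hdc], ?_⟩
  · rw [hdc, ← mul_assoc, ← mul_assoc, mul_assoc (p * s), hyp, mul_assoc (p * s), ← sq,
      mul_assoc, hy.mul_sq]
  · have e : p * s - (p * s) ^ 2 * (p * y) = p * (s - s ^ 2 * y) := by
      rw [sq, mul_assoc (p * s), hcd, ← mul_assoc (p * s), hsp]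
      noncomm_ring
    have e1 : (s - s ^ 2 * y) * (1 - p) = s * (1 - p) := by
      rw [sub_mul, mul_assoc _ y, hyq, mul_zero, sub_zero]
    rw [e]
    refine (isQuasinilpotent_iff_of_triangular hp ?_ ?_).1 hy.quasinilpotent
    · rw [mul_assoc, e1, ← mul_assoc, hs]
    · rwa [e1]

/-- The generalized Drazin inverse of a block lower triangular element whose lower diagonal block
is quasinilpotent. -/
theorem IsGDrazinInverse.of_triangular {p s d : A} (hp : p * p = p)
    (hs : p * s * (1 - p) = 0) (hq : IsQuasinilpotent (s * (1 - p)))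
    (hd : IsGDrazinInverse (p * s) d) :
    IsGDrazinInverse s
      (d + ∑' n : ℕ, (s * (1 - p)) ^ n * ((1 - p) * s * p) * d ^ (n + 2)) := by
  have hsp : p * s * p = p * s := by
    rw [mul_sub, mul_one, sub_eq_zero] at hs
    exact hs.symm
  have hqs : p * (s * (1 - p)) = 0 := by rw [← mul_assoc, hs]
  have hpd : p * d = d := by
    rw [← hd.mul_sq, ← mul_assoc, ← mul_assoc, hp]
  have hdp : d * p = d := by
    rw [← hd.sq_mul, mul_assoc, hsp]
  set q := s * (1 - p) with hq_def
  set u := (1 - p) * s * p with hu_def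
  have hpu : p * u = 0 := by
    rw [hu_def, ← mul_assoc, ← mul_assoc, mul_sub, mul_one, hp, sub_self, zero_mul, zero_mul]
  have hpz : ∀ n : ℕ, p * (q ^ n * u) = 0 := by
    rintro (_ | n)
    · rw [pow_zero, one_mul, hpu]
    · rw [pow_succ', mul_assoc, ← mul_assoc p, hqs, zero_mul]
  have hsum : Summable fun n : ℕ => q ^ n * u * d ^ (n + 1) := hq.summable_mul_pow u d
  -- `Z` is the common off-diagonal corner of `s * (d + X)` and `(d + X) * s`: it arises as `X * (p
  -- * s)` by `d ^ 2 * (p * s) = d`, and as `u * d + q * X` by shifting the index.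
  set Z := ∑' n : ℕ, q ^ n * u * d ^ (n + 1) with hZ
  set X := ∑' n : ℕ, q ^ n * u * d ^ (n + 2) with hX
  have hZd : Z * d = X := by
    rw [hZ, hX, ← hsum.tsum_mul_right]
    exact tsum_congr fun n => by rw [mul_assoc, ← pow_succ]
  have hsumX : Summable fun n : ℕ => q ^ n * u * d ^ (n + 2) := by
    refine (hsum.mul_right d).congr fun n => ?_
    rw [mul_assoc, ← pow_succ]
  have hXc : X * (p * s) = Z := by
    rw [hZ, hX, ← hsumX.tsum_mul_right]
    refine tsum_congr fun n => ?_
    rw [mul_assoc, pow_add, mul_assoc (d ^ n), hd.sq_mul, ← pow_succ]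
  have hqX : u * d + q * X = Z := by
    rw [hZ, hsum.tsum_eq_zero_add, hX, ← hsumX.tsum_mul_left]
    simp only [pow_zero, one_mul, zero_add, pow_one]
    refine congrArg _ (tsum_congr fun n => ?_)
    rw [pow_succ' q]
    simp only [mul_assoc]
  have hpZ : p * Z = 0 := by
    rw [hZ, ← hsum.tsum_mul_left]
    simp only [← mul_assoc p (_ * u), hpz, zero_mul, tsum_zero]
  have hpX : p * X = 0 := by rw [← hZd, ← mul_assoc, hpZ, zero_mul]
  have hXp : X * p = X := by rw [← hZd, mul_assoc, hdp]
  have hZp : Z * p = Z := by rw [← hXc, mul_assoc, hsp]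
  have hs_eq : s = p * s + u + q := by
    have : s = p * s + (1 - p) * s * p + (s * (1 - p) - p * (s * (1 - p))) := by noncomm_ring
    rw [hqs, sub_zero] at this
    exact this
  have hup : u * p = u := by rw [hu_def, mul_assoc, hp]
  have hqp : q * p = 0 := by rw [hq_def, mul_assoc, sub_mul, one_mul, hp, sub_self, mul_zero]
  have hsy : s * (d + X) = p * s * d + Z := by
    have h1 : p * s * X = 0 := by rw [← hsp, mul_assoc, hpX, mul_zero]
    have h2 : u * X = 0 := by rw [← hup, mul_assoc, hpX, mul_zero]
    have h3 : q * d = 0 := by rw [← hpd, ← mul_assoc, hqp, zero_mul]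
    conv_lhs => rw [hs_eq]
    rw [mul_add, add_mul, add_mul, add_mul, add_mul, h1, h2, h3, ← hqX]
    abel
  have hys : (d + X) * s = p * s * d + Z := by
    have h1 : d * s = p * s * d := by
      rw [hd.comm, ← mul_assoc, hdp]
    have h2 : X * s = Z := by rw [← hXc, ← mul_assoc, hXp]
    rw [add_mul, h1, h2]
  refine ⟨?_, by rw [hsy, hys], ?_⟩
  · have h1 : p * s * d * d = d := by rw [mul_assoc, ← sq, hd.mul_sq]
    have h2 : p * s * d * X = 0 := by rw [mul_assoc, ← hdp, mul_assoc d, hpX, mul_zero, mul_zero]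
    have h3 : Z * X = 0 := by rw [← hZp, mul_assoc, hpX, mul_zero]
    rw [hys, mul_add, add_mul, add_mul, h1, h2, h3, hZd]
    abel
  · have h1 : (d + X) * (1 - p) = 0 := by
      rw [mul_sub, mul_one, add_mul, hdp, hXp, sub_self]
    have e1 : (s - s ^ 2 * (d + X)) * (1 - p) = q := by
      rw [sub_mul, mul_assoc _ (d + X), h1, mul_zero, sub_zero]
    have e2 : p * (s - s ^ 2 * (d + X)) = p * s - (p * s) ^ 2 * d := by
      have h2 : p * s * Z = 0 := by rw [← hsp, mul_assoc, hpZ, mul_zero]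
      rw [sq, mul_assoc s, hsy, mul_sub, ← mul_assoc p s, mul_add, h2, add_zero, sq,
        mul_assoc (p * s) (p * s) d]
    -- The residue is again block lower triangular, with lower block `q` and upper block the residue
    -- of `p * s`.
    refine (isQuasinilpotent_iff_of_triangular hp ?_ ?_).2 ?_
    · rw [mul_assoc, e1, hqs]
    · rwa [e1]
    · rw [e2]
      exact hd.quasinilpotent

theorem isGDrazinInvertible_iff_of_triangular {p s : A} (hp : p * p = p)
    (hs : p * s * (1 - p) = 0) (hq : IsQuasinilpotent (s * (1 - p))) :
    IsGDrazinInvertible s ↔ IsGDrazinInvertible (p * s) :=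
  ⟨fun ⟨_, hy⟩ => ⟨_, hy.compress_of_triangular hp hs hq⟩,
    fun ⟨_, hd⟩ => ⟨_, hd.of_triangular hp hs hq⟩⟩

end Triangular

theorem corollary2p3 {A : Type*} [NormedRing A] [NormedAlgebra ℂ A] [CompleteSpace A]
    (a b c : A) (ha : IsGDrazinInvertible a) (hb : IsGDrazinInvertible b)
    (hba : b * spectralIdem a = 0) (hc : c = a * gDrazinInv a * (a + b)) :
    (IsGDrazinInvertible (a + b) ↔ IsGDrazinInvertible c) ∧
    (IsGDrazinInvertible c ↔ IsGDrazinInvertible (a ^ 2 * gDrazinInv a + b)) ∧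
    (IsGDrazinInvertible (a + b) →
      Summable (fun n : ℕ => a ^ n * spectralIdem a * b * gDrazinInv c ^ (n + 2)) ∧
      gDrazinInv (a + b) = gDrazinInv c +
        ∑' n : ℕ, a ^ n * spectralIdem a * b * gDrazinInv c ^ (n + 2)) := by
  obtain ⟨x, hx⟩ := ha
  rw [spectralIdem, gDrazinInv_eq hx] at *
  subst hc
  set p := a * x with hp_def
  have hp : p * p = p := by
    rw [hp_def, mul_assoc, ← mul_assoc x, hx.inner_eq]
  have hpa : Commute p a := by
    rw [commute_iff_eq, hp_def, mul_assoc a x a, ← hx.comm]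
  have hpp : p * (1 - p) = 0 := by rw [mul_sub, mul_one, hp, sub_self]
  have hca : Commute a (1 - p) := (Commute.one_right a).sub_right hpa.symm
  have haq : a - a ^ 2 * x = a * (1 - p) := by rw [hp_def]; noncomm_ring
  have hqa : (a + b) * (1 - p) = a * (1 - p) := by rw [add_mul, hba, add_zero]
  have hs : p * (a + b) * (1 - p) = 0 := by
    rw [mul_assoc, hqa, hca.eq, ← mul_assoc, hpp, zero_mul]
  have hq : IsQuasinilpotent ((a + b) * (1 - p)) := by
    rw [hqa, ← haq]
    exact hx.quasinilpotent
  have ha2 : a ^ 2 * x = a * p := by rw [sq, mul_assoc]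
  have hpt : p * (a ^ 2 * x + b) = p * (a + b) := by
    rw [ha2, ← hpa.eq, mul_add, ← mul_assoc, hp, mul_add]
  have hqt : (a ^ 2 * x + b) * (1 - p) = 0 := by
    rw [add_mul, hba, ha2, mul_assoc, hpp, mul_zero, add_zero]
  have hiff := isGDrazinInvertible_iff_of_triangular hp hs hq
  -- Here the lower block is `0`, and by `hpt` the upper block is again `c`.
  have hiff' := isGDrazinInvertible_iff_of_triangular (s := a ^ 2 * x + b) hp
    (by rw [mul_assoc, hqt, mul_zero]) (by rw [hqt]; exact isQuasinilpotent_zero)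
  rw [hpt] at hiff'
  refine ⟨hiff, hiff'.symm, fun h => ?_⟩
  obtain ⟨d, hd⟩ := hiff.1 h
  have hterm : ∀ n : ℕ, ((a + b) * (1 - p)) ^ n * ((1 - p) * (a + b) * p) * d ^ (n + 2) =
      a ^ n * (1 - p) * b * d ^ (n + 2) := by
    intro n
    have hid : (1 - p) * (1 - p) = 1 - p := by rw [sub_mul, one_mul, hpp, sub_zero]
    have hbp : b * p = b := by
      rw [mul_sub, mul_one, sub_eq_zero] at hba
      exact hba.symm
    have hu : (1 - p) * (a + b) * p = (1 - p) * b := by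
      rw [mul_assoc, add_mul, hbp, mul_add, ← hpa.eq, ← mul_assoc, sub_mul, one_mul, hp,
        sub_self, zero_mul, zero_add]
    -- The trailing `1 - p` makes the identity hold at `n = 0` too.
    have hpow : (a * (1 - p)) ^ n * (1 - p) = a ^ n * (1 - p) := by
      rw [hca.mul_pow, mul_assoc, ← pow_succ, IsIdempotentElem.pow_eq hid n.succ_ne_zero]
    rw [hqa, hu, ← mul_assoc _ (1 - p) b, hpow]
  rw [gDrazinInv_eq hd, gDrazinInv_eq (hd.of_triangular hp hs hq)]
  refine ⟨?_, by rw [tsum_congr hterm]⟩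
  refine ((hq.summable_mul_pow ((1 - p) * (a + b) * p) d).mul_right d).congr fun n => ?_
  rw [← hterm, mul_assoc, ← pow_succ]
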